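/- **Setting.** Let $\mathbb T_1,\mathbb T_2,\mathbb T_3$ be time scales (nonempty closed subsets of $\mathbb R$), $x_0\in\mathbb T_1$, $y_0\in\mathbb T_2$, let $a\le b$ be points of $\mathbb T_3$, and put $I=[a,b]\cap\mathbb T_3$ (the case $\mathbb T_3=\mathbb R$ is the real interval $[a,b]$), $H=\mathbb T_1\times\mathbb T_2\times I$ and $H_0=\{(x,y,z)\in H: x\ge x_0,\ y\ge y_0\}$. Let $\sigma$ and $\mu(\tau)=\sigma(\tau)-\tau$ denote the forward jump operator and the graininess. For a product of time scales, $C_{rd}$ denotes the real functions that are jointly rd-continuous: at every point $p$, say that a variable approaches $p_i$ properly if it tends to $p_i$ within its time scale when $p_i$ is right-dense, and if it is kept equal to $p_i$ otherwise; the function tends to its value at $p$ when all variables approach $p$ properly, and for every set $S$ of variables it has a finite joint limit when the variables in $S$ tend to $p_i$ strictly from the left and the others approach properly (a limit that is vacuous unless each $p_i$ with $i\in S$ is left-dense). In one variable this is ordinary rd-continuity. All integrals are delta integrals, and $$e_p(x,x_0)=\exp\Big(\int_{x_0}^x \xi_{\mu(\tau)}(p(\tau))\,\Delta\tau\Big),\qquad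 \xi_h(w)=\tfrac1h\log(1+hw)\ (h>0),\quad \xi_0(w)=w,$$ is the exponential function of $\mathbb T_1$. **Theorem 3.2.** Let $g,r,f\in C_{rd}(H,\mathbb R)$ and $F\in C_{rd}(H^2\times\mathbb R,\mathbb R)$, and suppose that $$|F(x,y,z,s,t,q,v)-F(x,y,z,s,t,q,w)|\le r(x,y,z)\,f(s,t,q)\,|v-w|$$ for all $(x,y,z),(s,t,q)\in H_0$ and $v,w\in\mathbb R$. If $u\in C_{rd}(H,\mathbb R)$ is a solution of $$u(x,y,z)=g(x,y,z)+\int_{x_0}^x\int_{y_0}^y\int_a^b F(x,y,z,s,t,q,u(s,t,q))\,\Delta q\,\Delta t\,\Delta s,\qquad (x,y,z)\in H_0,$$ then for all $(x,y,z)\in H_0$ $$|u(x,y,z)-g(x,y,z)|\le k(x,y,z)+r(x,y,z)\,C_3(x,y)\,e_{Q_2(\cdot,y)}(x,x_0),$$ where $$k(x,y,z)=\int_{x_0}^x\int_{y_0}^y\int_a^b|F(x,y,z,s,t,q,g(s,t,q))|\,\Delta q\,\Delta t\,\Delta s,$$ $$C_3(x,y)=\int_{x_0}^x\int_{y_0}^y\int_a^b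 f(s,t,q)\,|k(s,t,q)|\,\Delta q\,\Delta t\,\Delta s,$$ $$Q_2(x,y)=\int_{y_0}^y\int_a^b f(x,t,q)\,r(x,t,q)\,\Delta q\,\Delta t.$$ -/

import Mathlib

open Set Filter Topology MeasureTheory

noncomputable section

namespace TimeScale

/-- A time scale: a nonempty closed subset of the real line. -/
def IsTimeScale (T : Set ℝ) : Prop := T.Nonempty ∧ IsClosed T

open Classical in
/-- The forward jump operator `σ(t) = inf {s ∈ T : s > t}`,
with `σ(t) = t` when `t` is the maximum of `T`. -/
def sigma (T : Set ℝ) (t : ℝ) : ℝ :=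
  if (T ∩ Ioi t).Nonempty then sInf (T ∩ Ioi t) else t

/-- The graininess `μ(t) = σ(t) - t`. -/
def graininess (T : Set ℝ) (t : ℝ) : ℝ := sigma T t - t

/-- `t` is right-dense: `t < sup T` and `σ(t) = t`. -/
def RightDense (T : Set ℝ) (t : ℝ) : Prop := (T ∩ Ioi t).Nonempty ∧ sigma T t = t

open Classical in
/-- The filter along which a rd-continuous function has to be continuous at `t`: all points of `T`
near `t` if `t` is right-dense, and no condition (only `t` itself) otherwise. -/
def rdNhds (T : Set ℝ) (t : ℝ) : Filter ℝ :=
  if RightDense T t then 𝓝[T] t else pure t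

/-- The filter of the points of `T` that approach `t` from the left. It is trivial unless `t` is
left-dense. -/
def leftNhds (T : Set ℝ) (t : ℝ) : Filter ℝ := 𝓝[T ∩ Iio t] t

open Classical in
/-- (Joint) rd-continuity of a real function of finitely many variables on a product of time
scales. In one variable this says: `f` is continuous at every right-dense point and has a finite
left-sided limit at every left-dense point. In several variables, `f` is jointly continuous at `p`
along `rdNhds` in all coordinates, and for every set `S` of coordinates it has a finite joint limit
when the coordinates in `S` tend to `p` from the left and the others along `rdNhds`. If all the
time scales are `ℝ` this is joint continuity; if all are discrete it is no condition. -/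
def RdContinuous {ι : Type} (T : ι → Set ℝ) (f : (ι → ℝ) → ℝ) : Prop :=
  ∀ p : ι → ℝ, (∀ i, p i ∈ T i) →
    Tendsto f (Filter.pi fun i => rdNhds (T i) (p i)) (𝓝 (f p)) ∧
    ∀ S : Set ι, ∃ l : ℝ,
      Tendsto f (Filter.pi fun i =>
        if i ∈ S then leftNhds (T i) (p i) else rdNhds (T i) (p i)) (𝓝 l)

/-- `f ∈ C_rd(A × B × C, ℝ)`. -/
def Crd3 (A B C : Set ℝ) (f : ℝ → ℝ → ℝ → ℝ) : Prop :=
  RdContinuous ![A, B, C] fun p => f (p 0) (p 1) (p 2)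

/-- `F ∈ C_rd(H² × ℝ, ℝ)` with `H = A × B × C`. -/
def Crd7 (A B C : Set ℝ) (F : ℝ → ℝ → ℝ → ℝ → ℝ → ℝ → ℝ → ℝ) : Prop :=
  RdContinuous ![A, B, C, A, B, C, univ]
    fun p => F (p 0) (p 1) (p 2) (p 3) (p 4) (p 5) (p 6)

/-- The Lebesgue delta measure of the time scale `T`: Lebesgue measure on `T` together with an atom
of mass `μ(t) = σ(t) - t` at each right-scattered point `t` of `T`. It gives `[c, d) ∩ T` the mass
`d - c` for `c ≤ d` in `T`. -/
def deltaMeasure (T : Set ℝ) : Measure ℝ :=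
  volume.restrict T +
    Measure.sum fun t : {t : ℝ // t ∈ T ∧ t < sigma T t} =>
      ENNReal.ofReal (graininess T t) • Measure.dirac (t : ℝ)

/-- The delta integral `∫_c^d φ(t) Δt` over the time scale `T`, with the usual orientation:
the integral over `[c, d) ∩ T` if `c ≤ d`, and minus the integral over `[d, c) ∩ T` otherwise. -/
def deltaIntegral (T : Set ℝ) (c d : ℝ) (φ : ℝ → ℝ) : ℝ :=
  (∫ t in Ico c d, φ t ∂(deltaMeasure T)) - ∫ t in Ico d c, φ t ∂(deltaMeasure T)

/-- The cylinder transformation `ξ_h(w) = log (1 + h w) / h` for `h > 0`, and `ξ_0(w) = w`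
(used for `1 + h w > 0`). -/
def cylinder (h w : ℝ) : ℝ := if h = 0 then w else Real.log (1 + h * w) / h

/-- The time scale exponential `e_p(t, s) = exp (∫_s^t ξ_{μ(τ)}(p(τ)) Δτ)`
(for positively regressive `p`, that is, `1 + μ p > 0`). -/
def expTS (T : Set ℝ) (p : ℝ → ℝ) (t s : ℝ) : ℝ :=
  Real.exp (deltaIntegral T s t fun τ => cylinder (graininess T τ) (p τ))

/-- The iterated integral `∫_{x₀}^x ∫_{y₀}^y ∫_a^b φ(s,t,q) Δq Δt Δs`. -/
def tripleIntegral (T₁ T₂ T₃ : Set ℝ) (x₀ y₀ a b x y : ℝ) (φ : ℝ → ℝ → ℝ → ℝ) : ℝ :=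
  deltaIntegral T₁ x₀ x fun s =>
    deltaIntegral T₂ y₀ y fun t => deltaIntegral T₃ a b fun q => φ s t q

/-- `k(x,y,z) = ∫_{x₀}^x ∫_{y₀}^y ∫_a^b |F(x,y,z,s,t,q,g(s,t,q))| Δq Δt Δs`. -/
def kFun (T₁ T₂ T₃ : Set ℝ) (x₀ y₀ a b : ℝ) (F : ℝ → ℝ → ℝ → ℝ → ℝ → ℝ → ℝ → ℝ)
    (g : ℝ → ℝ → ℝ → ℝ) (x y z : ℝ) : ℝ :=
  tripleIntegral T₁ T₂ T₃ x₀ y₀ a b x y fun s t q => |F x y z s t q (g s t q)|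

/-- `C₃(x,y) = ∫_{x₀}^x ∫_{y₀}^y ∫_a^b f(s,t,q) |k(s,t,q)| Δq Δt Δs`. -/
def C₃ (T₁ T₂ T₃ : Set ℝ) (x₀ y₀ a b : ℝ) (f k : ℝ → ℝ → ℝ → ℝ) (x y : ℝ) : ℝ :=
  tripleIntegral T₁ T₂ T₃ x₀ y₀ a b x y fun s t q => f s t q * |k s t q|

/-- `Q₂(x,y) = ∫_{y₀}^y ∫_a^b f(x,t,q) r(x,t,q) Δq Δt`. -/
def Q₂ (T₂ T₃ : Set ℝ) (y₀ a b : ℝ) (f r : ℝ → ℝ → ℝ → ℝ) (x y : ℝ) : ℝ :=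
  deltaIntegral T₂ y₀ y fun t => deltaIntegral T₃ a b fun q => f x t q * r x t q

end TimeScale

end

/-!
# A Gronwall type bound for a Volterra-Fredholm equation on time scales

Subtracting `g` from the equation and using the Lipschitz condition bounds `w = |u - g|` by
`k(x,y,z) + |r(x,y,z)| ∫∫∫ |f| w`, the integral being taken over the points `(s,t,q)` with `s < x`
and `t < y`. The absolute values are harmless, since the Lipschitz condition makes every product
`r(x,y,z) f(s,t,q)` nonnegative. For fixed `Y` let `W(x)` be the integral of `|f| w` over the points
with `s < x` and `t < Y`. It dominates the integrals with `t < y`, so multiplying the bound by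
`|f|` and integrating gives `W(x) ≤ C₃(X,Y) + ∫_{x₀}^x Q₂(s,Y) W(s) Δs` for `x ≤ X`, and
Gronwall's inequality on `T₁` gives `W(X) ≤ C₃(X,Y) e_{Q₂(·,Y)}(X,x₀)` (`gronwall_box`).

Gronwall's inequality on a time scale (`gronwall_delta`) is reduced to the real line: on `[A, B)` the
delta measure is the image of Lebesgue measure under the map that collapses each gap `(t, σ(t))` to
`t` (`deltaMeasure_restrict_Ico`). The right-hand side of the inequality then becomes a Lipschitz
function `V`, linear on the gaps, with `V' ≤ p V`, where `p` equals `q` on the time scale and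
`q(t) / (1 + (s - t) q(t))` for `s` in the gap `(t, σ(t))`. The integral of `p` over this gap is
`log (1 + μ(t) q(t)) = μ(t) ξ_{μ(t)}(q(t))`, so the integral of `p` is the exponent of the time scale
exponential (`integral_density_eq`), and the bound follows by integrating `(log V)' ≤ p`.

All integrals exist because a jointly rd-continuous function is bounded on compact boxes
(`RdContinuous.bounded_on_compact`) and Borel (`RdContinuous.measurable_indicator`): the points that
are not right-dense are countable, so the product of the time scales is a countable union of Borel
pieces on which the function is continuous. The data are therefore replaced by bounded measurable
functions that agree with them on the box below `(X, Y)`, and iterated delta integrals by integrals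
over the product of the delta measures (`tripleIntegral_eq`).
-/

namespace TimeScale

/-! ### The forward jump operator -/

theorem le_sigma (T : Set ℝ) (t : ℝ) : t ≤ sigma T t := by
  unfold sigma
  split_ifs with h
  · exact le_csInf h fun x hx => hx.2.le
  · exact le_rfl

theorem sigma_le {T : Set ℝ} {t b : ℝ} (hb : b ∈ T) (h : t < b) : sigma T t ≤ b := by
  have hb' : b ∈ T ∩ Ioi t := ⟨hb, h⟩
  rw [sigma, if_pos ⟨b, hb'⟩]
  exact csInf_le ⟨t, fun x hx => hx.2.le⟩ hb'

theorem not_mem_of_mem_Ioo_sigma {T : Set ℝ} {t x : ℝ} (hx : x ∈ Ioo t (sigma T t)) : x ∉ T :=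
  fun h => (sigma_le h hx.1).not_gt hx.2

theorem sigma_mono (T : Set ℝ) : Monotone (sigma T) := by
  intro s t hst
  rcases hst.eq_or_lt with rfl | hst
  · exact le_rfl
  by_cases h : (T ∩ Ioi t).Nonempty
  · rw [sigma.eq_1 T t, if_pos h]
    exact le_csInf h fun x hx => sigma_le hx.1 (hst.trans hx.2)
  · by_cases h' : (T ∩ Ioi s).Nonempty
    · obtain ⟨x, hx⟩ := h'
      refine (sigma_le hx.1 hx.2).trans (le_trans ?_ (le_sigma T t))
      by_contra! hlt
      exact h ⟨x, hx.1, hlt⟩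
    · rw [sigma.eq_1 T s, if_neg h']
      exact hst.le.trans (le_sigma T t)

/-! ### Boundedness and measurability of rd-continuous functions -/

theorem rdNhds_of_rightDense {T : Set ℝ} {t : ℝ} (h : RightDense T t) : rdNhds T t = 𝓝[T] t :=
  if_pos h

theorem rdNhds_of_not_rightDense {T : Set ℝ} {t : ℝ} (h : ¬ RightDense T t) :
    rdNhds T t = pure t :=
  if_neg h

/-- The right-scattered points of a time scale, together with its maximum, form a countable set:
the gaps to their right are disjoint intervals. -/
theorem countable_not_rightDense (T : Set ℝ) : {t ∈ T | ¬ RightDense T t}.Countable := by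
  refine (countable_setOfPred_isolated_right_within (s := T)).mono ?_
  rintro t ⟨ht, h⟩
  refine ⟨ht, ?_⟩
  rw [← empty_mem_iff_bot, mem_nhdsWithin_iff_eventually]
  by_cases hne : (T ∩ Ioi t).Nonempty
  · have hlt : t < sigma T t :=
      lt_of_le_of_ne (le_sigma T t) fun h' => h ⟨hne, h'.symm⟩
    filter_upwards [Iio_mem_nhds hlt] with x hx hxT
    exact not_mem_of_mem_Ioo_sigma ⟨hxT.2, hx⟩ hxT.1
  · exact Eventually.of_forall fun x hx => hne ⟨x, hx⟩

/-- A point of `T` near `t` either approaches `t` from the left, or properly. -/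
theorem nhdsWithin_le_sup (T : Set ℝ) (t : ℝ) : 𝓝[T] t ≤ leftNhds T t ⊔ rdNhds T t := by
  by_cases h : RightDense T t
  · rw [rdNhds_of_rightDense h]
    exact le_sup_right
  · rw [rdNhds_of_not_rightDense h]
    by_cases hne : (T ∩ Ioi t).Nonempty
    · have hlt : t < sigma T t :=
        lt_of_le_of_ne (le_sigma T t) fun h' => h ⟨hne, h'.symm⟩
      intro U hU
      obtain ⟨h₁, h₂⟩ := mem_sup.1 hU
      rw [leftNhds, mem_nhdsWithin_iff_eventually] at h₁
      rw [mem_nhdsWithin_iff_eventually]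
      filter_upwards [h₁, Iio_mem_nhds hlt] with x hx hx' hxT
      rcases lt_trichotomy x t with h | h | h
      · exact hx ⟨hxT, h⟩
      · exact h ▸ h₂
      · exact absurd hxT (not_mem_of_mem_Ioo_sigma ⟨h, hx'⟩)
    · intro U hU
      obtain ⟨h₁, h₂⟩ := mem_sup.1 hU
      rw [leftNhds, mem_nhdsWithin_iff_eventually] at h₁
      rw [mem_nhdsWithin_iff_eventually]
      filter_upwards [h₁] with x hx hxT
      rcases lt_trichotomy x t with h | h | h
      · exact hx ⟨hxT, h⟩
      · exact h ▸ h₂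
      · exact absurd ⟨x, hxT, h⟩ hne

section RdContinuous

variable {ι : Type} [Finite ι] {T : ι → Set ℝ} {f : (ι → ℝ) → ℝ}

/-- For each of the finitely many choices of variables that come from the left, the existence of
the limit bounds `f` on a box; these boxes together cover a neighbourhood of `p`. -/
theorem RdContinuous.locally_bounded (hf : RdContinuous T f) {p : ι → ℝ}
    (hp : ∀ i, p i ∈ T i) :
    ∃ U ∈ 𝓝[Set.pi univ T] p, ∃ M, ∀ q ∈ U, |f q| ≤ M := by
  classical
  have key : ∀ S : Set ι, ∃ M : ℝ, ∃ V : ι → Set ℝ,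
      (∀ i, V i ∈ if i ∈ S then leftNhds (T i) (p i) else rdNhds (T i) (p i)) ∧
      ∀ q ∈ Set.pi univ V, |f q| ≤ M := by
    intro S
    obtain ⟨l, hl⟩ := (hf p hp).2 S
    have h := hl.abs.eventually (eventually_le_nhds (lt_add_one |l|))
    obtain ⟨I, -, V, hV, hsub⟩ := Filter.mem_pi.1 h
    refine ⟨|l| + 1, V, hV, fun q hq => hsub fun i _ => hq i (mem_univ i)⟩
  choose M V hV hM using key
  have : Finite (Set ι) := inferInstance
  obtain ⟨B, hB⟩ := (Set.finite_range M).bddAbove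
  let L : ι → Set ℝ := fun i => ⋂ S : {S : Set ι // i ∈ S}, V S i
  let R : ι → Set ℝ := fun i => ⋂ S : {S : Set ι // i ∉ S}, V S i
  have hL : ∀ i, L i ∈ leftNhds (T i) (p i) := fun i =>
    iInter_mem.2 fun S => by simpa [S.2] using hV S i
  have hR : ∀ i, R i ∈ rdNhds (T i) (p i) := fun i =>
    iInter_mem.2 fun S => by simpa [S.2] using hV S i
  refine ⟨Set.pi univ fun i => L i ∪ R i, ?_, B, ?_⟩
  · rw [nhdsWithin_pi_univ_eq]
    refine Filter.pi_mem_pi Set.finite_univ fun i _ => ?_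
    exact nhdsWithin_le_sup _ _ (mem_sup.2
      ⟨mem_of_superset (hL i) subset_union_left, mem_of_superset (hR i) subset_union_right⟩)
  · intro q hq
    refine (hM {i | q i ∈ L i} q fun i _ => ?_).trans (hB (mem_range_self _))
    by_cases hi : q i ∈ L i
    · exact mem_iInter.1 hi ⟨{i | q i ∈ L i}, hi⟩
    · exact mem_iInter.1 ((hq i (mem_univ i)).resolve_left hi) ⟨{i | q i ∈ L i}, hi⟩

theorem RdContinuous.bounded_on_compact (hf : RdContinuous T f) {K : Set (ι → ℝ)}
    (hK : IsCompact K) (hKT : K ⊆ Set.pi univ T) : ∃ M, ∀ q ∈ K, |f q| ≤ M := by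
  refine hK.induction_on (p := fun s => ∃ M, ∀ q ∈ s, |f q| ≤ M) ⟨0, by simp⟩ ?_ ?_ ?_
  · rintro s t hst ⟨M, hM⟩
    exact ⟨M, fun q hq => hM q (hst hq)⟩
  · rintro s t ⟨M, hM⟩ ⟨N, hN⟩
    refine ⟨max M N, fun q hq => ?_⟩
    rcases hq with hq | hq
    · exact (hM q hq).trans (le_max_left _ _)
    · exact (hN q hq).trans (le_max_right _ _)
  · intro p hp
    obtain ⟨U, hU, M, hM⟩ := hf.locally_bounded fun i => hKT hp i (mem_univ i)
    exact ⟨U, nhdsWithin_mono p hKT hU, M, hM⟩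

/-- A jointly rd-continuous function is Borel on the product of the time scales. The product is
cut into countably many pieces, on each of which some of the coordinates are kept at given
points that are not right-dense and the others run through right-dense points; `f` is continuous
on each piece. -/
theorem RdContinuous.measurable_indicator (hf : RdContinuous T f) (hT : ∀ i, IsClosed (T i))
    {K : Set (ι → ℝ)} (hK : MeasurableSet K) (hKT : K ⊆ Set.pi univ T) :
    Measurable (K.indicator f) := by
  classical
  let D : ι → Set ℝ := fun i => {t ∈ T i | ¬ RightDense (T i) t}
  have hD : ∀ i, (D i).Countable := fun i => countable_not_rightDense (T i)
  have : ∀ i, Countable (D i) := fun i => (hD i).to_subtype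
  let A : ∀ i, Option (D i) → Set ℝ := fun i o => o.elim (T i \ D i) fun c => {(c : ℝ)}
  have hA : ∀ i o, MeasurableSet (A i o) := by
    rintro i (_ | c)
    · exact (hT i).measurableSet.diff (hD i).measurableSet
    · exact measurableSet_singleton _
  let E : (∀ i, Option (D i)) → Set (ι → ℝ) := fun d => Set.pi univ fun i => A i (d i)
  have hE : ∀ d, MeasurableSet (E d) := fun d =>
    MeasurableSet.univ_pi fun i => hA i (d i)
  have hET : ∀ d, E d ⊆ Set.pi univ T := by
    intro d p hp i _
    have h := hp i (mem_univ i)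
    cases hdi : d i with
    | none => simp only [hdi] at h; exact h.1
    | some c => simp only [hdi] at h; exact (mem_singleton_iff.1 h) ▸ c.2.1
  have hcont : ∀ d, ContinuousOn f (E d) := by
    intro d p hp
    refine ((hf p fun i => hET d hp i (mem_univ i)).1).mono_left ?_
    rw [nhdsWithin_pi_univ_eq]
    refine Filter.pi_mono fun i => ?_
    have h := hp i (mem_univ i)
    cases hdi : d i with
    | none =>
      simp only [hdi] at h ⊢
      have hrd : RightDense (T i) (p i) := by
        by_contra hn
        exact h.2 ⟨h.1, hn⟩
      rw [rdNhds_of_rightDense hrd]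
      exact nhdsWithin_mono _ sdiff_subset
    | some c =>
      simp only [hdi] at h ⊢
      have hpc : p i = c := h
      rw [rdNhds_of_not_rightDense (hpc ▸ c.2.2)]
      simp [A, hpc]
  have hcover : ∀ p ∈ Set.pi univ T, ∃ d, p ∈ E d := by
    intro p hp
    refine ⟨fun i => if h : p i ∈ D i then some ⟨p i, h⟩ else none, fun i _ => ?_⟩
    by_cases h : p i ∈ D i
    · simp [A, h]
    · simp only [h, dite_false, A]
      exact ⟨hp i (mem_univ i), h⟩
  have hpre : ∀ U : Set ℝ, IsOpen U → MeasurableSet (K ∩ f ⁻¹' U) := by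
    intro U hU
    have : K ∩ f ⁻¹' U = ⋃ d, K ∩ (f ⁻¹' U ∩ E d) := by
      ext p
      simp only [mem_inter_iff, mem_iUnion]
      constructor
      · rintro ⟨h₁, h₂⟩
        obtain ⟨d, hd⟩ := hcover p (hKT h₁)
        exact ⟨d, h₁, h₂, hd⟩
      · rintro ⟨d, h₁, h₂, -⟩
        exact ⟨h₁, h₂⟩
    rw [this]
    refine MeasurableSet.iUnion fun d => hK.inter ?_
    obtain ⟨u, hu, huE⟩ := continuousOn_iff'.1 (hcont d) U hU
    rw [huE]
    exact hu.measurableSet.inter (hE d)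
  refine measurable_of_isOpen fun U hU => ?_
  rw [indicator_preimage]
  have h0 : MeasurableSet ((0 : (ι → ℝ) → ℝ) ⁻¹' U) := measurable_zero hU.measurableSet
  have : K.ite (f ⁻¹' U) (0 ⁻¹' U) = (K ∩ f ⁻¹' U) ∪ (0 ⁻¹' U) \ K := by
    rw [Set.ite, inter_comm]
  rw [this]
  exact (hpre U hU).union (h0.diff hK)

end RdContinuous

/-! ### The delta measure as an image of Lebesgue measure -/

/-- The largest point of `T` that is at most `s`, for `s ≥ A`; below `A` it is kept constant, so
that it is monotone on the whole line and takes values in `T` as soon as `A ∈ T`. -/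
noncomputable def floorTS (T : Set ℝ) (A s : ℝ) : ℝ := sSup (T ∩ Iic (max A s))

/-- The part of the gap to the right of `t` that is sent into `S` by `floorTS`: the whole gap if
`t ∈ S`, and nothing otherwise. -/
def gap (T S : Set ℝ) (t : ℝ) : Set ℝ := {τ ∈ Ioo t (sigma T t) | t ∈ S}

section Floor

variable {T : Set ℝ} {A B s t : ℝ}

theorem floorTS_mem (hT : IsClosed T) (hA : A ∈ T) (s : ℝ) :
    floorTS T A s ∈ T ∩ Iic (max A s) :=
  (hT.inter isClosed_Iic).csSup_mem ⟨A, hA, mem_Iic.2 (le_max_left _ _)⟩ ⟨max A s, fun _ hx => hx.2⟩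

theorem le_floorTS (ht : t ∈ T) (h : t ≤ max A s) : t ≤ floorTS T A s :=
  le_csSup ⟨max A s, fun _ hx => hx.2⟩ ⟨ht, h⟩

theorem floorTS_le (hT : IsClosed T) (hA : A ∈ T) (h : A ≤ s) : floorTS T A s ≤ s := by
  have := (floorTS_mem hT hA s).2
  rwa [max_eq_right h] at this

theorem floorTS_mono (hT : IsClosed T) (hA : A ∈ T) : Monotone (floorTS T A) := fun s _ hst =>
  le_floorTS (floorTS_mem hT hA s).1 ((floorTS_mem hT hA s).2.trans (max_le_max_left A hst))

theorem floorTS_of_mem (hT : IsClosed T) (hA : A ∈ T) (hs : s ∈ T) (h : A ≤ s) :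
    floorTS T A s = s :=
  le_antisymm (floorTS_le hT hA h) (le_floorTS hs (le_max_right _ _))

theorem floorTS_of_gap (hT : IsClosed T) (hA : A ∈ T) (ht : t ∈ T) (h : A ≤ t)
    (hs : s ∈ Ioo t (sigma T t)) : floorTS T A s = t := by
  refine le_antisymm ?_ (le_floorTS ht (hs.1.le.trans (le_max_right _ _)))
  by_contra! hlt
  exact ((sigma_le (floorTS_mem hT hA s).1 hlt).trans
    (floorTS_le hT hA (h.trans hs.1.le))).not_gt hs.2

theorem mem_gap_floorTS (hT : IsClosed T) (hA : A ∈ T) (hB : B ∈ T) (h : A ≤ s) (hsB : s < B)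
    (hs : s ∉ T) : s ∈ Ioo (floorTS T A s) (sigma T (floorTS T A s)) := by
  have hf := floorTS_mem hT hA s
  have hle := floorTS_le hT hA h
  have hlt : floorTS T A s < s := lt_of_le_of_ne hle fun he => hs (he ▸ hf.1)
  have hne : (T ∩ Ioi (floorTS T A s)).Nonempty := ⟨B, hB, hlt.trans hsB⟩
  refine ⟨hlt, ?_⟩
  rw [sigma, if_pos hne]
  have hmem : sInf (T ∩ Ioi (floorTS T A s)) ∈ T :=
    hT.closure_subset_iff.2 inter_subset_left
      (csInf_mem_closure hne ⟨floorTS T A s, fun _ hx => hx.2.le⟩)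
  refine lt_of_le_of_ne (le_csInf hne fun x hx => ?_) fun he => hs (he ▸ hmem)
  by_contra! hxs
  exact (le_floorTS hx.1 (hxs.le.trans (le_max_right A s))).not_gt hx.2

theorem floorTS_preimage_inter_Ico (hT : IsClosed T) (hA : A ∈ T) (hB : B ∈ T) (S : Set ℝ) :
    floorTS T A ⁻¹' S ∩ Ico A B = (S ∩ Ico A B) ∩ T ∪
      ⋃ t : {t : ℝ // t ∈ T ∧ t < sigma T t}, gap T (S ∩ Ico A B) t := by
  ext s
  simp only [mem_inter_iff, mem_preimage, mem_union, mem_iUnion, gap, mem_ofPred_eq]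
  constructor
  · rintro ⟨hS, hs⟩
    by_cases hsT : s ∈ T
    · rw [floorTS_of_mem hT hA hsT hs.1] at hS
      exact Or.inl ⟨⟨hS, hs⟩, hsT⟩
    · have hg := mem_gap_floorTS hT hA hB hs.1 hs.2 hsT
      refine Or.inr ⟨⟨floorTS T A s, (floorTS_mem hT hA s).1, hg.1.trans hg.2⟩, hg, hS,
        le_floorTS hA (le_max_left _ _), hg.1.trans hs.2⟩
  · rintro (⟨⟨hS, hs⟩, hsT⟩ | ⟨⟨t, ht⟩, hg, hS, hs⟩)
    · rw [floorTS_of_mem hT hA hsT hs.1]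
      exact ⟨hS, hs⟩
    · rw [floorTS_of_gap hT hA ht.1 hs.1 hg]
      exact ⟨hS, hs.1.trans hg.1.le, hg.2.trans_le (sigma_le hB hs.2)⟩

theorem gap_of_mem {S : Set ℝ} (ht : t ∈ S) : gap T S t = Ioo t (sigma T t) :=
  Set.ext fun _ => and_iff_left ht

theorem measurableSet_gap (T S : Set ℝ) (t : ℝ) : MeasurableSet (gap T S t) :=
  measurableSet_Ioo.inter (MeasurableSet.const _)

theorem gap_pairwise_disjoint (T S : Set ℝ) :
    Pairwise (Function.onFun Disjoint
      fun t : {t : ℝ // t ∈ T ∧ t < sigma T t} => gap T S t) := by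
  intro s t hst
  refine Set.disjoint_left.2 fun x hxs hxt => ?_
  obtain ⟨hs, -⟩ := hxs
  obtain ⟨ht, -⟩ := hxt
  rcases lt_or_gt_of_ne (Subtype.coe_ne_coe.2 hst) with h | h
  · exact (sigma_le t.2.1 h).not_gt (ht.1.trans hs.2)
  · exact (sigma_le s.2.1 h).not_gt (hs.1.trans ht.2)

theorem disjoint_iUnion_gap (T S S' : Set ℝ) :
    Disjoint (S' ∩ T) (⋃ t : {t : ℝ // t ∈ T ∧ t < sigma T t}, gap T S t) := by
  refine Set.disjoint_left.2 fun x hx hx' => ?_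
  obtain ⟨t, ht, -⟩ := mem_iUnion.1 hx'
  exact not_mem_of_mem_Ioo_sigma ht hx.2

instance countable_rightScattered (T : Set ℝ) : Countable {t : ℝ // t ∈ T ∧ t < sigma T t} :=
  ((countable_not_rightDense T).mono fun _ (ht : _ ∈ T ∧ _) =>
    (⟨ht.1, fun h => ht.2.ne' h.2⟩ : _ ∈ T ∧ ¬ RightDense T _)).to_subtype

/-- On `[A, B)` with `A, B ∈ T`, the delta measure is the image of Lebesgue measure under the map
that collapses each gap of `T` to its left end. -/
theorem deltaMeasure_restrict_Ico (hT : IsClosed T) (hA : A ∈ T) (hB : B ∈ T) :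
    (deltaMeasure T).restrict (Ico A B) =
      (volume.restrict (Ico A B)).map (floorTS T A) := by
  have hm : Measurable (floorTS T A) := (floorTS_mono hT hA).measurable
  ext S hS
  have hSI : MeasurableSet (S ∩ Ico A B) := hS.inter measurableSet_Ico
  rw [Measure.map_apply hm hS, Measure.restrict_apply hS, Measure.restrict_apply (hm hS),
    floorTS_preimage_inter_Ico hT hA hB, measure_union (disjoint_iUnion_gap T _ _)
      (MeasurableSet.iUnion fun t => measurableSet_gap T _ t),
    measure_iUnion (gap_pairwise_disjoint T _) (fun t => measurableSet_gap T _ t),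
    deltaMeasure, Measure.add_apply, Measure.restrict_apply hSI, Measure.sum_apply _ hSI]
  congr 2
  ext t
  rw [Measure.smul_apply, Measure.dirac_apply' _ hSI, smul_eq_mul]
  by_cases ht : (t : ℝ) ∈ S ∩ Ico A B
  · rw [gap_of_mem ht]
    simp [ht, graininess, -mem_inter_iff]
  · simp [gap, ht, -mem_inter_iff]

theorem isFiniteMeasure_deltaMeasure_restrict (hT : IsClosed T) (hA : A ∈ T) (hB : B ∈ T) :
    IsFiniteMeasure ((deltaMeasure T).restrict (Ico A B)) := by
  rw [deltaMeasure_restrict_Ico hT hA hB]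
  infer_instance

theorem ae_mem_deltaMeasure_restrict (hT : IsClosed T) (hA : A ∈ T) (hB : B ∈ T) :
    ∀ᵐ t ∂(deltaMeasure T).restrict (Ico A B), t ∈ T ∩ Icc A B := by
  rw [deltaMeasure_restrict_Ico hT hA hB]
  refine (ae_map_iff (floorTS_mono hT hA).measurable.aemeasurable
    (hT.inter isClosed_Icc).measurableSet).2 ?_
  filter_upwards [ae_restrict_mem measurableSet_Ico] with s hs
  exact ⟨(floorTS_mem hT hA s).1, le_floorTS hA (le_max_left _ _),
    (floorTS_le hT hA hs.1).trans hs.2.le⟩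

/-- Delta integrals as Lebesgue integrals. -/
theorem integral_deltaMeasure (hT : IsClosed T) (hA : A ∈ T) (hB : B ∈ T) (hAB : A ≤ B)
    {φ : ℝ → ℝ} (hφ : Measurable φ) :
    ∫ t in Ico A B, φ t ∂deltaMeasure T = ∫ s in A..B, φ (floorTS T A s) := by
  rw [deltaMeasure_restrict_Ico hT hA hB,
    integral_map (floorTS_mono hT hA).measurable.aemeasurable hφ.aestronglyMeasurable,
    integral_Ico_eq_integral_Ioc, intervalIntegral.integral_of_le hAB]

end Floor

/-! ### Gronwall's inequality in one variable -/

section Gronwall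

theorem intervalIntegrable_of_bounded {M : ℝ} {φ : ℝ → ℝ} (hφ : Measurable φ) (a b : ℝ)
    (h : ∀ s ∈ uIoc a b, |φ s| ≤ M) : IntervalIntegrable φ volume a b :=
  (intervalIntegrable_const (c := M)).mono_fun hφ.aestronglyMeasurable
    ((ae_restrict_mem measurableSet_uIoc).mono fun s hs => by
      simpa only [Real.norm_eq_abs] using (h s hs).trans (le_abs_self M))

/-- Gronwall's inequality for a bounded measurable coefficient: the logarithm of the right-hand
side is Lipschitz, hence the integral of its derivative, which is at most `p`. -/
theorem gronwall_lebesgue {A B C M : ℝ} (hAB : A ≤ B) (hC : 0 < C) {v p : ℝ → ℝ}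
    (hv : Measurable v) (hv0 : ∀ s, 0 ≤ v s) (hvM : ∀ s, v s ≤ M)
    (hp : IntervalIntegrable p volume A B)
    (h : ∀ s ∈ Ico A B, v s ≤ p s * (C + ∫ t in A..s, v t)) :
    C + ∫ t in A..B, v t ≤ C * Real.exp (∫ t in A..B, p t) := by
  have hM0 : 0 ≤ M := (hv0 0).trans (hvM 0)
  have hvi : ∀ a b, IntervalIntegrable v volume a b := fun a b =>
    intervalIntegrable_of_bounded (M := M) hv _ _ fun s _ => by
      rw [abs_of_nonneg (hv0 s)]; exact hvM s
  set V : ℝ → ℝ := fun s => C + ∫ t in A..s, v t with hV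
  have hsub : ∀ s t, V t - V s = ∫ τ in s..t, v τ := fun s t => by
    simp only [hV]
    rw [add_sub_add_left_eq_sub, intervalIntegral.integral_interval_sub_left (hvi _ _) (hvi _ _)]
  have hmono : Monotone V := fun s t hst =>
    sub_nonneg.1 (hsub s t ▸ intervalIntegral.integral_nonneg hst fun τ _ => hv0 τ)
  have hVA : V A = C := by simp [hV]
  have hVC : ∀ s, A ≤ s → C ≤ V s := fun s hs => hVA ▸ hmono hs
  have hLip : ∀ s t, s ≤ t → V t - V s ≤ M * (t - s) := fun s t hst => by
    rw [hsub]
    have := intervalIntegral.integral_mono_on hst (hvi s t) intervalIntegrable_const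
      fun x _ => hvM x
    simpa [mul_comm] using this
  have hlogLip : LipschitzOnWith (Real.toNNReal (M / C)) (fun s => Real.log (V s))
      (uIcc A B) := by
    refine LipschitzOnWith.of_le_add_mul _ fun s hs t ht => ?_
    rw [uIcc_of_le hAB] at hs ht
    rw [Real.coe_toNNReal _ (by positivity), Real.dist_eq]
    have hVs := hC.trans_le (hVC s hs.1)
    have hVt := hC.trans_le (hVC t ht.1)
    rcases le_total s t with hst | hst
    · have := Real.log_le_log hVs (hmono hst)
      have : 0 ≤ M / C * |s - t| := by positivity
      linarith
    · have h1 : Real.log (V s) - Real.log (V t) ≤ V s / V t - 1 := by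
        rw [← Real.log_div hVs.ne' hVt.ne']
        exact Real.log_le_sub_one_of_pos (by positivity)
      have h2 : V s / V t - 1 ≤ M / C * |s - t| := by
        rw [abs_of_nonneg (sub_nonneg.2 hst), div_sub_one hVt.ne', div_mul_eq_mul_div]
        exact div_le_div₀ (mul_nonneg hM0 (sub_nonneg.2 hst)) (hLip t s hst) hC (hVC t ht.1)
      linarith
  have hac := hlogLip.absolutelyContinuousOnInterval
  have hderiv : ∀ᵐ s, s ∈ uIcc A B → HasDerivAt V (v s) s := by
    filter_upwards [(hvi A B).ae_hasDerivAt_integral] with s hs hsI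
    exact (hs hsI A left_mem_uIcc).const_add C
  have hle : ∫ s in A..B, deriv (fun s => Real.log (V s)) s ≤ ∫ s in A..B, p s := by
    refine intervalIntegral.integral_mono_ae_restrict hAB hac.intervalIntegrable_deriv hp ?_
    rw [Measure.restrict_congr_set Ico_ae_eq_Icc.symm]
    filter_upwards [ae_restrict_of_ae hderiv, ae_restrict_mem measurableSet_Ico] with s hs hsI
    have hVs := hC.trans_le (hVC s hsI.1)
    have hd := hs (by rw [uIcc_of_le hAB]; exact Ico_subset_Icc_self hsI)
    rw [(hd.log hVs.ne').deriv, div_le_iff₀ hVs]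
    exact h s hsI
  rw [hac.integral_deriv_eq_sub, hVA] at hle
  have hVB := hC.trans_le (hVC B hAB)
  change V B ≤ _
  rw [← Real.exp_log hVB, ← Real.exp_log hC, ← Real.exp_add]
  exact Real.exp_le_exp.2 (by linarith)

theorem integral_gap {q t b : ℝ} (hq : 0 ≤ q) (htb : t ≤ b) :
    ∫ s in t..b, q / (1 + (s - t) * q) = Real.log (1 + (b - t) * q) := by
  have hpos : ∀ s ∈ uIcc t b, 0 < 1 + (s - t) * q := by
    intro s hs
    rw [uIcc_of_le htb] at hs
    have := mul_nonneg (sub_nonneg.2 hs.1) hq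
    linarith
  rw [intervalIntegral.integral_eq_sub_of_hasDerivAt
    (f := fun s => Real.log (1 + (s - t) * q)) ?_ ?_]
  · simp
  · intro s hs
    have h1 : HasDerivAt (fun s => 1 + (s - t) * q) q s := by
      simpa using (((hasDerivAt_id s).sub_const t).mul_const q).const_add 1
    exact h1.log (hpos s hs).ne'
  · refine ContinuousOn.intervalIntegrable ?_
    exact continuousOn_const.div (by fun_prop) fun s hs => (hpos s hs).ne'

theorem cylinder_nonneg {h w : ℝ} (hh : 0 ≤ h) (hw : 0 ≤ w) : 0 ≤ cylinder h w := by
  unfold cylinder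
  split_ifs
  · exact hw
  · exact div_nonneg (Real.log_nonneg (by nlinarith [mul_nonneg hh hw])) hh

theorem cylinder_le {h w : ℝ} (hh : 0 ≤ h) (hw : 0 ≤ w) : cylinder h w ≤ w := by
  unfold cylinder
  split_ifs with h0
  · exact le_rfl
  · have hpos : 0 < h := lt_of_le_of_ne hh (Ne.symm h0)
    rw [div_le_iff₀ hpos]
    have := Real.log_le_sub_one_of_pos (show 0 < 1 + h * w by nlinarith [mul_nonneg hh hw])
    linarith

theorem measurable_cylinder_graininess (T : Set ℝ) {q : ℝ → ℝ} (hq : Measurable q) :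
    Measurable fun t => cylinder (graininess T t) (q t) := by
  have hg : Measurable (graininess T) := (sigma_mono T).measurable.sub measurable_id
  unfold cylinder
  exact Measurable.ite (hg (measurableSet_singleton 0)) hq
    ((measurable_const.add (hg.mul hq)).log.div hg)

variable {T : Set ℝ} {A B M : ℝ} {q : ℝ → ℝ}

/-- The exponent of the time scale exponential as a Lebesgue integral: across a gap `(t, σ(t))` the
density `q / (1 + (s - t) q)` is the logarithmic derivative of the linear function
`1 + (s - t) q`. -/
theorem integral_density_eq (hT : IsClosed T) (hA : A ∈ T) (hB : B ∈ T) (hAB : A ≤ B)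
    (hq : Measurable q) (hq0 : ∀ s, 0 ≤ q s) (hqM : ∀ s, q s ≤ M) :
    ∫ s in A..B, q (floorTS T A s) / (1 + (s - floorTS T A s) * q (floorTS T A s)) =
      ∫ t in Ico A B, cylinder (graininess T t) (q t) ∂deltaMeasure T := by
  have hm : Measurable (floorTS T A) := (floorTS_mono hT hA).measurable
  have hcm := measurable_cylinder_graininess T hq
  have hgr : ∀ t, 0 ≤ graininess T t := fun t => sub_nonneg.2 (le_sigma T t)
  set p : ℝ → ℝ := fun s => q (floorTS T A s) / (1 + (s - floorTS T A s) * q (floorTS T A s))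
  set c : ℝ → ℝ := fun s => cylinder (graininess T (floorTS T A s)) (q (floorTS T A s))
  have hpm : Measurable p := (hq.comp hm).div
    (measurable_const.add ((measurable_id.sub hm).mul (hq.comp hm)))
  have hpi : IntegrableOn p (Ico A B) := by
    rw [integrableOn_Ico_iff_integrableOn_Ioo, ← integrableOn_Ioc_iff_integrableOn_Ioo,
      ← intervalIntegrable_iff_integrableOn_Ioc_of_le hAB]
    refine intervalIntegrable_of_bounded (M := M) hpm _ _ fun s hs => ?_
    rw [uIoc_of_le hAB] at hs
    have h0 := hq0 (floorTS T A s)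
    have h1 : 1 ≤ 1 + (s - floorTS T A s) * q (floorTS T A s) := by
      have := mul_nonneg (sub_nonneg.2 (floorTS_le hT hA hs.1.le)) h0
      linarith
    rw [abs_of_nonneg (div_nonneg h0 (by linarith))]
    exact (div_le_self h0 h1).trans (hqM _)
  have hci : IntegrableOn c (Ico A B) := by
    rw [integrableOn_Ico_iff_integrableOn_Ioo, ← integrableOn_Ioc_iff_integrableOn_Ioo,
      ← intervalIntegrable_iff_integrableOn_Ioc_of_le hAB]
    refine intervalIntegrable_of_bounded (M := M) (hcm.comp hm) _ _ fun s hs => ?_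
    change |cylinder _ _| ≤ M
    rw [abs_of_nonneg (cylinder_nonneg (hgr _) (hq0 _))]
    exact (cylinder_le (hgr _) (hq0 _)).trans (hqM _)
  rw [integral_deltaMeasure hT hA hB hAB hcm, intervalIntegral.integral_of_le hAB,
    intervalIntegral.integral_of_le hAB, ← integral_Ico_eq_integral_Ioc,
    ← integral_Ico_eq_integral_Ioc]
  have hdec : Ico A B = (Ico A B ∩ T) ∪
      ⋃ t : {t : ℝ // t ∈ T ∧ t < sigma T t}, gap T (Ico A B) t := by
    simpa using floorTS_preimage_inter_Ico hT hA hB univ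
  have hUm : MeasurableSet (⋃ t : {t : ℝ // t ∈ T ∧ t < sigma T t}, gap T (Ico A B) t) :=
    MeasurableSet.iUnion fun t => measurableSet_gap T _ t
  have hdisj := disjoint_iUnion_gap T (Ico A B) (Ico A B)
  have hsub1 : Ico A B ∩ T ⊆ Ico A B := inter_subset_left
  have hsub2 : (⋃ t : {t : ℝ // t ∈ T ∧ t < sigma T t}, gap T (Ico A B) t) ⊆ Ico A B := by
    intro x hx
    rw [hdec]
    exact Or.inr hx
  rw [hdec, setIntegral_union hdisj hUm (hpi.mono_set hsub1) (hpi.mono_set hsub2),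
    setIntegral_union hdisj hUm (hci.mono_set hsub1) (hci.mono_set hsub2),
    integral_iUnion (fun t : {t : ℝ // t ∈ T ∧ t < sigma T t} => measurableSet_gap T _ t)
      (gap_pairwise_disjoint T _)
      (hpi.mono_set hsub2),
    integral_iUnion (fun t : {t : ℝ // t ∈ T ∧ t < sigma T t} => measurableSet_gap T _ t)
      (gap_pairwise_disjoint T _)
      (hci.mono_set hsub2)]
  congr 1
  · -- right-scattered points are countably many, so they do not contribute to this part
    refine setIntegral_congr_ae (measurableSet_Ico.inter hT.measurableSet) ?_
    have hnull := ((countable_not_rightDense T).measure_zero volume)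
    filter_upwards [measure_eq_zero_iff_ae_notMem.1 hnull] with s hs hsI
    have hrd : RightDense T s := by
      by_contra hn
      exact hs ⟨hsI.2, hn⟩
    simp only [p, c]
    rw [floorTS_of_mem hT hA hsI.2 hsI.1.1, graininess, hrd.2]
    simp [cylinder]
  · refine tsum_congr fun t => ?_
    obtain ⟨t, ht, hlt⟩ := t
    by_cases htI : t ∈ Ico A B
    · simp only [gap_of_mem htI]
      have h1 : ∫ s in Ioo t (sigma T t), p s =
          ∫ s in Ioo t (sigma T t), q t / (1 + (s - t) * q t) := by
        refine setIntegral_congr_fun measurableSet_Ioo fun s hs => ?_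
        simp only [p]
        rw [floorTS_of_gap hT hA ht htI.1 hs]
      have h2 : ∫ s in Ioo t (sigma T t), c s =
          ∫ s in Ioo t (sigma T t), cylinder (graininess T t) (q t) := by
        refine setIntegral_congr_fun measurableSet_Ioo fun s hs => ?_
        simp only [c]
        rw [floorTS_of_gap hT hA ht htI.1 hs]
      have hne : sigma T t - t ≠ 0 := (sub_pos.2 hlt).ne'
      rw [h1, h2, ← integral_Ioc_eq_integral_Ioo, ← integral_Ioc_eq_integral_Ioo,
        ← intervalIntegral.integral_of_le hlt.le, ← intervalIntegral.integral_of_le hlt.le,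
        integral_gap (hq0 t) hlt.le, intervalIntegral.integral_const, smul_eq_mul, cylinder,
        graininess, if_neg hne]
      field_simp
    · have hg : gap T (Ico A B) t = ∅ := by
        ext s; simp [gap, htI, -mem_Ico]
      simp [hg]

/-- Gronwall's inequality on a time scale. Collapsing gaps turns the hypothesis into one about
Lebesgue integrals; in a gap the right-hand side is extended linearly, and there the coefficient
`q` has to be replaced by the smaller density `q / (1 + (s - t) q)`. -/
theorem gronwall_delta (hT : IsClosed T) (hA : A ∈ T) (hB : B ∈ T) (hAB : A ≤ B)
    (hq : Measurable q) (hq0 : ∀ s, 0 ≤ q s) (hqM : ∀ s, q s ≤ M)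
    {W : ℝ → ℝ} {N : ℝ} (hW : Measurable W) (hW0 : ∀ s, 0 ≤ W s) (hWN : ∀ s, W s ≤ N)
    {C : ℝ} (hC : 0 ≤ C)
    (h : ∀ s ∈ T ∩ Icc A B, W s ≤ C + ∫ t in Ico A s, q t * W t ∂deltaMeasure T) :
    W B ≤ C * Real.exp (∫ t in Ico A B, cylinder (graininess T t) (q t) ∂deltaMeasure T) := by
  have hm : Measurable (floorTS T A) := (floorTS_mono hT hA).measurable
  set v : ℝ → ℝ := fun s => q (floorTS T A s) * W (floorTS T A s)
  have hvm : Measurable v := (hq.comp hm).mul (hW.comp hm)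
  have hM0 : 0 ≤ M := (hq0 0).trans (hqM 0)
  have hv0 : ∀ s, 0 ≤ v s := fun s => mul_nonneg (hq0 _) (hW0 _)
  have hvM : ∀ s, v s ≤ M * N := fun s => mul_le_mul (hqM _) (hWN _) (hW0 _) hM0
  have hvi : ∀ a b, IntervalIntegrable v volume a b := fun a b =>
    intervalIntegrable_of_bounded (M := M * N) hvm _ _ fun s _ => by
      rw [abs_of_nonneg (hv0 s)]; exact hvM s
  have h' : ∀ s ∈ T ∩ Icc A B, W s ≤ C + ∫ t in A..s, v t := fun s hs => by
    have := h s hs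
    rwa [integral_deltaMeasure hT hA hs.1 hs.2.1 (φ := fun t => q t * W t) (hq.mul hW)] at this
  rw [← integral_density_eq hT hA hB hAB hq hq0 hqM]
  set p : ℝ → ℝ := fun s => q (floorTS T A s) / (1 + (s - floorTS T A s) * q (floorTS T A s))
  have hden : ∀ s, A ≤ s → 1 ≤ 1 + (s - floorTS T A s) * q (floorTS T A s) := fun s hs => by
    have := mul_nonneg (sub_nonneg.2 (floorTS_le hT hA hs)) (hq0 (floorTS T A s))
    linarith
  have hpi : IntervalIntegrable p volume A B := by
    refine intervalIntegrable_of_bounded (M := M) ((hq.comp hm).div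
      (measurable_const.add ((measurable_id.sub hm).mul (hq.comp hm)))) _ _ fun s hs => ?_
    rw [uIoc_of_le hAB] at hs
    have h1 := hden s hs.1.le
    have h0 := hq0 (floorTS T A s)
    change |q (floorTS T A s) / (1 + (s - floorTS T A s) * q (floorTS T A s))| ≤ M
    rw [abs_of_nonneg (div_nonneg h0 (by linarith))]
    exact (div_le_self h0 h1).trans (hqM _)
  -- positive constants first, for the logarithm; then the limit
  have main : ∀ ε > 0, W B ≤ (C + ε) * Real.exp (∫ s in A..B, p s) := by
    intro ε hε
    have hWB : W B ≤ C + ε + ∫ t in A..B, v t := by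
      have := h' B ⟨hB, hAB, le_rfl⟩
      linarith
    refine hWB.trans (gronwall_lebesgue hAB (by linarith) hvm hv0 hvM hpi fun s hs => ?_)
    set t := floorTS T A s
    have htT : t ∈ T := (floorTS_mem hT hA s).1
    have hAt : A ≤ t := le_floorTS hA (le_max_left _ _)
    have hts : t ≤ s := floorTS_le hT hA hs.1
    have hint : ∫ τ in t..s, v τ = (s - t) * (q t * W t) := by
      have : ∫ τ in t..s, v τ = ∫ τ in t..s, q t * W t := by
        refine intervalIntegral.integral_congr fun τ hτ => ?_
        rw [uIcc_of_le hts] at hτ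
        have he : floorTS T A τ = t := le_antisymm (floorTS_mono hT hA hτ.2)
          (le_floorTS htT (hτ.1.trans (le_max_right _ _)))
        simp only [v, he]
      rw [this, intervalIntegral.integral_const, smul_eq_mul]
    have hWt := h' t ⟨htT, hAt, hts.trans hs.2.le⟩
    rw [← intervalIntegral.integral_add_adjacent_intervals (hvi A t) (hvi t s), hint]
    set I := ∫ τ in A..t, v τ
    have hd : 0 < 1 + (s - t) * q t := lt_of_lt_of_le one_pos (hden s hs.1)
    change q t * W t ≤ q t / (1 + (s - t) * q t) * (C + ε + (I + (s - t) * (q t * W t)))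
    rw [div_mul_eq_mul_div, le_div_iff₀ hd, mul_assoc]
    refine mul_le_mul_of_nonneg_left ?_ (hq0 t)
    nlinarith
  have hlim : Tendsto (fun ε : ℝ => (C + ε) * Real.exp (∫ s in A..B, p s)) (𝓝[>] 0)
      (𝓝 ((C + 0) * Real.exp (∫ s in A..B, p s))) :=
    ((tendsto_const_nhds.add tendsto_id).mul_const _).mono_left nhdsWithin_le_nhds
  rw [add_zero] at hlim
  exact ge_of_tendsto hlim (eventually_mem_nhdsWithin.mono main)

end Gronwall

/-! ### Bounded measurable functions -/

/-- Bounded measurable real functions. -/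
def BddMeas {α : Type*} [MeasurableSpace α] (φ : α → ℝ) : Prop :=
  Measurable φ ∧ ∃ M, ∀ a, |φ a| ≤ M

section BddMeas

variable {α β : Type*} [MeasurableSpace α] [MeasurableSpace β] {φ ψ : α → ℝ}

theorem BddMeas.add (hφ : BddMeas φ) (hψ : BddMeas ψ) : BddMeas fun a => φ a + ψ a := by
  obtain ⟨M, hM⟩ := hφ.2
  obtain ⟨N, hN⟩ := hψ.2
  exact ⟨hφ.1.add hψ.1, M + N, fun a => (abs_add_le _ _).trans (add_le_add (hM a) (hN a))⟩

theorem BddMeas.mul (hφ : BddMeas φ) (hψ : BddMeas ψ) : BddMeas fun a => φ a * ψ a := by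
  obtain ⟨M, hM⟩ := hφ.2
  obtain ⟨N, hN⟩ := hψ.2
  refine ⟨hφ.1.mul hψ.1, M * N, fun a => ?_⟩
  rw [abs_mul]
  exact mul_le_mul (hM a) (hN a) (abs_nonneg _) ((abs_nonneg _).trans (hM a))

theorem BddMeas.sub (hφ : BddMeas φ) (hψ : BddMeas ψ) : BddMeas fun a => φ a - ψ a := by
  obtain ⟨M, hM⟩ := hφ.2
  obtain ⟨N, hN⟩ := hψ.2
  exact ⟨hφ.1.sub hψ.1, M + N, fun a => (abs_sub _ _).trans (add_le_add (hM a) (hN a))⟩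

theorem BddMeas.abs (hφ : BddMeas φ) : BddMeas fun a => |φ a| := by
  obtain ⟨M, hM⟩ := hφ.2
  exact ⟨hφ.1.abs, M, fun a => by rw [abs_abs]; exact hM a⟩

theorem BddMeas.comp {g : β → α} (hφ : BddMeas φ) (hg : Measurable g) :
    BddMeas fun b => φ (g b) := by
  obtain ⟨M, hM⟩ := hφ.2
  exact ⟨hφ.1.comp hg, M, fun b => hM (g b)⟩

theorem BddMeas.const (c : ℝ) : BddMeas fun _ : α => c :=
  ⟨measurable_const, |c|, fun _ => le_rfl⟩

theorem BddMeas.ite {p : α → Prop} [DecidablePred p] (hφ : BddMeas φ)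
    (hp : MeasurableSet {a | p a}) : BddMeas fun a => if p a then φ a else 0 := by
  obtain ⟨M, hM⟩ := hφ.2
  refine ⟨hφ.1.ite hp measurable_const, M, fun a => ?_⟩
  dsimp only
  split_ifs
  · exact hM a
  · simpa using (abs_nonneg _).trans (hM a)

theorem BddMeas.integrable (hφ : BddMeas φ) (μ : Measure α) [IsFiniteMeasure μ] :
    Integrable φ μ := by
  obtain ⟨M, hM⟩ := hφ.2
  exact Integrable.of_bound hφ.1.aestronglyMeasurable M (Eventually.of_forall hM)

theorem BddMeas.integral {χ : α → β → ℝ} (hχ : BddMeas fun p : α × β => χ p.1 p.2)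
    (μ : Measure β) [IsFiniteMeasure μ] : BddMeas fun a => ∫ b, χ a b ∂μ := by
  obtain ⟨M, hM⟩ := hχ.2
  refine ⟨(hχ.1.stronglyMeasurable.integral_prod_right (ν := μ)).measurable,
    M * μ.real univ, fun a => ?_⟩
  exact norm_integral_le_of_norm_le_const (f := fun b => χ a b)
    (Eventually.of_forall fun b => hM (a, b))

end BddMeas

/-- On compact subsets of the time scales, a function in `C_rd` of three variables agrees with a
bounded measurable function on the whole space. -/
theorem Crd3.exists_bddMeas {A B C K₁ K₂ K₃ : Set ℝ} {h : ℝ → ℝ → ℝ → ℝ} (hh : Crd3 A B C h)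
    (hA : IsClosed A) (hB : IsClosed B) (hC : IsClosed C)
    (h₁ : IsCompact K₁) (h₂ : IsCompact K₂) (h₃ : IsCompact K₃)
    (h₁A : K₁ ⊆ A) (h₂B : K₂ ⊆ B) (h₃C : K₃ ⊆ C) :
    ∃ h' : ℝ × ℝ × ℝ → ℝ, BddMeas h' ∧
      ∀ p ∈ K₁ ×ˢ K₂ ×ˢ K₃, h' p = h p.1 p.2.1 p.2.2 := by
  have hK : IsCompact (Set.pi univ ![K₁, K₂, K₃]) :=
    isCompact_univ_pi (by simp [Fin.forall_fin_succ, h₁, h₂, h₃])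
  have hKT : Set.pi univ ![K₁, K₂, K₃] ⊆ Set.pi univ ![A, B, C] :=
    Set.pi_mono (by simp [Fin.forall_fin_succ, h₁A, h₂B, h₃C])
  have hm := RdContinuous.measurable_indicator hh (by simp [Fin.forall_fin_succ, hA, hB, hC])
    hK.measurableSet hKT
  obtain ⟨M, hM⟩ := RdContinuous.bounded_on_compact hh hK hKT
  have hbd : BddMeas ((Set.pi univ ![K₁, K₂, K₃]).indicator
      fun p : Fin 3 → ℝ => h (p 0) (p 1) (p 2)) := by
    refine ⟨hm, max M 0, fun p => ?_⟩
    by_cases hp : p ∈ Set.pi univ ![K₁, K₂, K₃]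
    · rw [indicator_of_mem hp]
      exact (hM p hp).trans (le_max_left _ _)
    · rw [indicator_of_notMem hp, abs_zero]
      exact le_max_right _ _
  refine ⟨_, hbd.comp (g := fun p : ℝ × ℝ × ℝ => ![p.1, p.2.1, p.2.2]) ?_, ?_⟩
  · refine measurable_pi_iff.2 ?_
    simp only [Fin.forall_fin_succ, IsEmpty.forall_iff, and_true, Matrix.cons_val_zero,
      Matrix.cons_val_succ]
    exact ⟨by fun_prop, by fun_prop, by fun_prop⟩
  · rintro ⟨x, y, z⟩ ⟨hx, hy, hz⟩
    rw [indicator_of_mem]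
    · rfl
    · simpa [Set.mem_pi, Fin.forall_fin_succ] using ⟨hx, hy, hz⟩

/-- The analogue for the kernel, whose last variable is real and is kept in `[-N, N]`. -/
theorem Crd7.exists_bddMeas {A B C K₁ K₂ K₃ : Set ℝ}
    {F : ℝ → ℝ → ℝ → ℝ → ℝ → ℝ → ℝ → ℝ} (hF : Crd7 A B C F)
    (hA : IsClosed A) (hB : IsClosed B) (hC : IsClosed C)
    (h₁ : IsCompact K₁) (h₂ : IsCompact K₂) (h₃ : IsCompact K₃)
    (h₁A : K₁ ⊆ A) (h₂B : K₂ ⊆ B) (h₃C : K₃ ⊆ C) (N : ℝ) :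
    ∃ F' : (ℝ × ℝ × ℝ) × (ℝ × ℝ × ℝ) × ℝ → ℝ, BddMeas F' ∧
      ∀ p ∈ K₁ ×ˢ K₂ ×ˢ K₃, ∀ p' ∈ K₁ ×ˢ K₂ ×ˢ K₃, ∀ v, |v| ≤ N →
        F' (p, p', v) = F p.1 p.2.1 p.2.2 p'.1 p'.2.1 p'.2.2 v := by
  set K : Fin 7 → Set ℝ := ![K₁, K₂, K₃, K₁, K₂, K₃, Icc (-N) N] with hKdef
  have hK : IsCompact (Set.pi univ K) :=
    isCompact_univ_pi (by simp [hKdef, Fin.forall_fin_succ, h₁, h₂, h₃, isCompact_Icc])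
  have hKT : Set.pi univ K ⊆ Set.pi univ ![A, B, C, A, B, C, univ] :=
    Set.pi_mono (by simp [hKdef, Fin.forall_fin_succ, h₁A, h₂B, h₃C])
  have hm := RdContinuous.measurable_indicator hF (by simp [Fin.forall_fin_succ, hA, hB, hC])
    hK.measurableSet hKT
  obtain ⟨M, hM⟩ := RdContinuous.bounded_on_compact hF hK hKT
  have hbd : BddMeas ((Set.pi univ K).indicator
      fun p : Fin 7 → ℝ => F (p 0) (p 1) (p 2) (p 3) (p 4) (p 5) (p 6)) := by
    refine ⟨hm, max M 0, fun p => ?_⟩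
    by_cases hp : p ∈ Set.pi univ K
    · rw [indicator_of_mem hp]
      exact (hM p hp).trans (le_max_left _ _)
    · rw [indicator_of_notMem hp, abs_zero]
      exact le_max_right _ _
  refine ⟨_, hbd.comp (g := fun p : (ℝ × ℝ × ℝ) × (ℝ × ℝ × ℝ) × ℝ =>
    ![p.1.1, p.1.2.1, p.1.2.2, p.2.1.1, p.2.1.2.1, p.2.1.2.2, p.2.2]) ?_, ?_⟩
  · refine measurable_pi_iff.2 ?_
    simp only [Fin.forall_fin_succ, IsEmpty.forall_iff, and_true, Matrix.cons_val_zero,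
      Matrix.cons_val_succ]
    exact ⟨by fun_prop, by fun_prop, by fun_prop, by fun_prop, by fun_prop, by fun_prop,
      by fun_prop⟩
  · rintro ⟨x, y, z⟩ ⟨hx, hy, hz⟩ ⟨s, t, q⟩ ⟨hs, ht, hq⟩ v hv
    rw [indicator_of_mem]
    · rfl
    · simpa [hKdef, Set.mem_pi, Fin.forall_fin_succ] using
        ⟨hx, hy, hz, hs, ht, hq, abs_le.1 hv⟩

/-! ### Iterated delta integrals over a box -/

theorem deltaIntegral_of_le {T : Set ℝ} {c d : ℝ} (h : c ≤ d) (φ : ℝ → ℝ) :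
    deltaIntegral T c d φ = ∫ t in Ico c d, φ t ∂deltaMeasure T := by
  simp [deltaIntegral, Ico_eq_empty h.not_gt]

theorem setIntegral_deltaMeasure_congr {T : Set ℝ} (hT : IsClosed T) {A B : ℝ} (hA : A ∈ T)
    (hB : B ∈ T) {φ ψ : ℝ → ℝ} (h : ∀ t ∈ T ∩ Icc A B, φ t = ψ t) :
    ∫ t in Ico A B, φ t ∂deltaMeasure T = ∫ t in Ico A B, ψ t ∂deltaMeasure T :=
  integral_congr_ae ((ae_mem_deltaMeasure_restrict hT hA hB).mono h)

theorem setIntegral_Ico_ite {μ : Measure ℝ} {A B x : ℝ} (hx : x ≤ B) (φ : ℝ → ℝ) :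
    ∫ t in Ico A B, (if t < x then φ t else 0) ∂μ = ∫ t in Ico A x, φ t ∂μ := by
  have h : (fun t => if t < x then φ t else 0) = (Iio x).indicator φ := by
    ext t
    simp [indicator]
  have h' : Ico A B ∩ Iio x = Ico A x := by
    rw [Ico_inter_Iio, min_eq_right hx]
  rw [h, setIntegral_indicator measurableSet_Iio, h']

/-- The product of the delta measures of three time scales on the box
`[x₀, X) × [y₀, Y) × [a, b)`. -/
noncomputable def boxMeasure (T₁ T₂ T₃ : Set ℝ) (x₀ X y₀ Y a b : ℝ) : Measure (ℝ × ℝ × ℝ) :=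
  ((deltaMeasure T₁).restrict (Ico x₀ X)).prod
    (((deltaMeasure T₂).restrict (Ico y₀ Y)).prod ((deltaMeasure T₃).restrict (Ico a b)))

theorem BddMeas.cut {φ : ℝ × ℝ × ℝ → ℝ} (hφ : BddMeas φ) (x y : ℝ) :
    BddMeas fun p : ℝ × ℝ × ℝ => if p.1 < x ∧ p.2.1 < y then φ p else 0 :=
  hφ.ite (by measurability)

theorem BddMeas.cut_fst {φ : ℝ × ℝ × ℝ → ℝ} (hφ : BddMeas φ) (x : ℝ) :
    BddMeas fun p : ℝ × ℝ × ℝ => if p.1 < x then φ p else 0 :=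
  hφ.ite (by measurability)

theorem BddMeas.integral_cut {ν : Measure (ℝ × ℝ × ℝ)} [IsFiniteMeasure ν]
    {χ : ℝ × ℝ × ℝ → ℝ × ℝ × ℝ → ℝ} (hχ : BddMeas fun p : (ℝ × ℝ × ℝ) × ℝ × ℝ × ℝ => χ p.1 p.2) :
    BddMeas fun p : ℝ × ℝ × ℝ =>
      ∫ p', (if p'.1 < p.1 ∧ p'.2.1 < p.2.1 then χ p p' else 0) ∂ν := by
  refine BddMeas.integral (χ := fun p p' : ℝ × ℝ × ℝ =>
    if p'.1 < p.1 ∧ p'.2.1 < p.2.1 then χ p p' else 0) ?_ ν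
  exact hχ.ite (by measurability)

theorem BddMeas.integral_cut_fst {ν : Measure (ℝ × ℝ × ℝ)} [IsFiniteMeasure ν]
    {φ : ℝ × ℝ × ℝ → ℝ} (hφ : BddMeas φ) :
    BddMeas fun x : ℝ => ∫ p, (if p.1 < x then φ p else 0) ∂ν := by
  refine BddMeas.integral (χ := fun (x : ℝ) (p : ℝ × ℝ × ℝ) => if p.1 < x then φ p else 0) ?_ ν
  exact BddMeas.ite (hφ.comp measurable_snd) (by measurability)

section Box

variable {T₁ T₂ T₃ : Set ℝ} {x₀ X y₀ Y a b : ℝ}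

/-- An iterated integral up to a point `(x, y)` of the box is an integral over the whole box of a
function cut off at `(x, y)`; this makes the dependence on `(x, y)` visible in the integrand. -/
theorem tripleIntegral_eq (h₁ : IsClosed T₁) (h₂ : IsClosed T₂) (h₃ : IsClosed T₃)
    (hx₀ : x₀ ∈ T₁) (hX : X ∈ T₁) (hy₀ : y₀ ∈ T₂) (hY : Y ∈ T₂) (ha : a ∈ T₃) (hb : b ∈ T₃)
    (hab : a ≤ b) {x y : ℝ} (hx : x ∈ T₁ ∩ Icc x₀ X) (hy : y ∈ T₂ ∩ Icc y₀ Y)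
    {φ : ℝ → ℝ → ℝ → ℝ} {φ' : ℝ × ℝ × ℝ → ℝ} (hφ' : BddMeas φ')
    (h : ∀ p ∈ (T₁ ∩ Icc x₀ X) ×ˢ (T₂ ∩ Icc y₀ Y) ×ˢ (T₃ ∩ Icc a b),
      φ' p = φ p.1 p.2.1 p.2.2) :
    tripleIntegral T₁ T₂ T₃ x₀ y₀ a b x y φ =
      ∫ p, (if p.1 < x ∧ p.2.1 < y then φ' p else 0) ∂boxMeasure T₁ T₂ T₃ x₀ X y₀ Y a b := by
  have := isFiniteMeasure_deltaMeasure_restrict h₁ hx₀ hX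
  have := isFiniteMeasure_deltaMeasure_restrict h₂ hy₀ hY
  have := isFiniteMeasure_deltaMeasure_restrict h₃ ha hb
  have hcut : BddMeas fun p : ℝ × ℝ × ℝ => if p.1 < x ∧ p.2.1 < y then φ' p else 0 :=
    hφ'.cut x y
  rw [boxMeasure, integral_prod _ (hcut.integrable _), tripleIntegral, deltaIntegral_of_le hx.2.1,
    ← setIntegral_Ico_ite hx.2.2]
  refine setIntegral_deltaMeasure_congr h₁ hx₀ hX fun s hs => ?_
  rw [integral_prod _ ((hcut.comp measurable_prodMk_left).integrable _)]
  split_ifs with hsx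
  · rw [deltaIntegral_of_le hy.2.1, ← setIntegral_Ico_ite hy.2.2]
    refine setIntegral_deltaMeasure_congr h₂ hy₀ hY fun t ht => ?_
    split_ifs with hty
    · rw [deltaIntegral_of_le hab]
      refine setIntegral_deltaMeasure_congr h₃ ha hb fun q hq => ?_
      simp only [hsx, hty, and_self, if_true]
      exact (h (s, t, q) ⟨hs, ht, hq⟩).symm
    · simp [hty]
  · simp [hsx]

theorem isFiniteMeasure_boxMeasure (h₁ : IsClosed T₁) (h₂ : IsClosed T₂) (h₃ : IsClosed T₃)
    (hx₀ : x₀ ∈ T₁) (hX : X ∈ T₁) (hy₀ : y₀ ∈ T₂) (hY : Y ∈ T₂) (ha : a ∈ T₃) (hb : b ∈ T₃) :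
    IsFiniteMeasure (boxMeasure T₁ T₂ T₃ x₀ X y₀ Y a b) := by
  have := isFiniteMeasure_deltaMeasure_restrict h₁ hx₀ hX
  have := isFiniteMeasure_deltaMeasure_restrict h₂ hy₀ hY
  have := isFiniteMeasure_deltaMeasure_restrict h₃ ha hb
  unfold boxMeasure
  infer_instance

theorem ae_mem_boxMeasure (h₁ : IsClosed T₁) (h₂ : IsClosed T₂) (h₃ : IsClosed T₃)
    (hx₀ : x₀ ∈ T₁) (hX : X ∈ T₁) (hy₀ : y₀ ∈ T₂) (hY : Y ∈ T₂) (ha : a ∈ T₃) (hb : b ∈ T₃) :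
    ∀ᵐ p ∂boxMeasure T₁ T₂ T₃ x₀ X y₀ Y a b,
      p ∈ (T₁ ∩ Icc x₀ X) ×ˢ (T₂ ∩ Icc y₀ Y) ×ˢ (T₃ ∩ Icc a b) ∧ p.1 < X ∧ p.2.1 < Y := by
  have := isFiniteMeasure_deltaMeasure_restrict h₁ hx₀ hX
  have := isFiniteMeasure_deltaMeasure_restrict h₂ hy₀ hY
  have := isFiniteMeasure_deltaMeasure_restrict h₃ ha hb
  have e₁ := (ae_mem_deltaMeasure_restrict h₁ hx₀ hX).and (ae_restrict_mem measurableSet_Ico)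
  have e₂ := (ae_mem_deltaMeasure_restrict h₂ hy₀ hY).and (ae_restrict_mem measurableSet_Ico)
  have e₃ := ae_mem_deltaMeasure_restrict h₃ ha hb
  unfold boxMeasure
  filter_upwards [Measure.quasiMeasurePreserving_fst.ae e₁,
    Measure.quasiMeasurePreserving_snd.ae (Measure.quasiMeasurePreserving_fst.ae e₂),
    Measure.quasiMeasurePreserving_snd.ae (Measure.quasiMeasurePreserving_snd.ae e₃)]
    with p hp₁ hp₂ hp₃
  exact ⟨⟨hp₁.1, hp₂.1, hp₃⟩, hp₁.2.2, hp₂.2.2⟩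

/-! ### Gronwall's inequality on a box -/

/-- Gronwall's inequality for a function `w` of three variables that is bounded through its own
integral over the part of the box below `(x, y)`. Enlarging this part to all `y` bounds `w` by
`κ + ρ W(x)`, where `W(x)` is the integral of `φ w` over the points with first coordinate less
than `x`; then `W` satisfies a Gronwall inequality in the single variable `x`. -/
theorem gronwall_box (h₁ : IsClosed T₁) (h₂ : IsClosed T₂) (h₃ : IsClosed T₃)
    (hx₀ : x₀ ∈ T₁) (hX : X ∈ T₁) (hy₀ : y₀ ∈ T₂) (hY : Y ∈ T₂) (ha : a ∈ T₃) (hb : b ∈ T₃)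
    (hxX : x₀ ≤ X) {φ ρ κ w : ℝ × ℝ × ℝ → ℝ} (hφ : BddMeas φ) (hρ : BddMeas ρ) (hκ : BddMeas κ)
    (hw : BddMeas w) (hφ0 : ∀ p, 0 ≤ φ p) (hρ0 : ∀ p, 0 ≤ ρ p) (hκ0 : ∀ p, 0 ≤ κ p)
    (hw0 : ∀ p, 0 ≤ w p)
    (h : ∀ p ∈ (T₁ ∩ Icc x₀ X) ×ˢ (T₂ ∩ Icc y₀ Y) ×ˢ (T₃ ∩ Icc a b),
      w p ≤ κ p + ρ p * ∫ p', (if p'.1 < p.1 ∧ p'.2.1 < p.2.1 then φ p' * w p' else 0)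
        ∂boxMeasure T₁ T₂ T₃ x₀ X y₀ Y a b) :
    ∀ p ∈ (T₁ ∩ Icc x₀ X) ×ˢ (T₂ ∩ Icc y₀ Y) ×ˢ (T₃ ∩ Icc a b), p.1 = X →
      w p ≤ κ p + ρ p * ((∫ p', φ p' * κ p' ∂boxMeasure T₁ T₂ T₃ x₀ X y₀ Y a b) *
        Real.exp (∫ s in Ico x₀ X, cylinder (graininess T₁ s) (∫ p', φ (s, p') * ρ (s, p')
          ∂(((deltaMeasure T₂).restrict (Ico y₀ Y)).prod ((deltaMeasure T₃).restrict (Ico a b))))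
          ∂deltaMeasure T₁)) := by
  have fin₁ := isFiniteMeasure_deltaMeasure_restrict h₁ hx₀ hX
  have fin₂ := isFiniteMeasure_deltaMeasure_restrict h₂ hy₀ hY
  have fin₃ := isFiniteMeasure_deltaMeasure_restrict h₃ ha hb
  have := isFiniteMeasure_boxMeasure h₁ h₂ h₃ hx₀ hX hy₀ hY ha hb
  have hae := ae_mem_boxMeasure h₁ h₂ h₃ hx₀ hX hy₀ hY ha hb
  set ν := boxMeasure T₁ T₂ T₃ x₀ X y₀ Y a b with hν
  set W : ℝ → ℝ := fun x => ∫ p', (if p'.1 < x then φ p' * w p' else 0) ∂ν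
  have hφw0 : ∀ p, 0 ≤ φ p * w p := fun p => mul_nonneg (hφ0 p) (hw0 p)
  have hφκ0 : ∀ p, 0 ≤ φ p * κ p := fun p => mul_nonneg (hφ0 p) (hκ0 p)
  have hW : BddMeas W := (hφ.mul hw).integral_cut_fst
  have hW0 : ∀ x, 0 ≤ W x := fun x => integral_nonneg fun p' => by
    dsimp only
    split_ifs
    · exact hφw0 _
    · exact le_rfl
  have hwW : ∀ p ∈ (T₁ ∩ Icc x₀ X) ×ˢ (T₂ ∩ Icc y₀ Y) ×ˢ (T₃ ∩ Icc a b),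
      w p ≤ κ p + ρ p * W p.1 := fun p hp => by
    refine (h p hp).trans (add_le_add_right (mul_le_mul_of_nonneg_left ?_ (hρ0 p)) _)
    refine integral_mono (((hφ.mul hw).cut _ _).integrable ν)
      (((hφ.mul hw).cut_fst _).integrable ν) fun p' => ?_
    dsimp only
    split_ifs with h h' h'
    · exact le_rfl
    · exact absurd h.1 h'
    · exact hφw0 _
    · exact le_rfl
  set C : ℝ := ∫ p, φ p * κ p ∂ν
  have hC : 0 ≤ C := integral_nonneg hφκ0
  set Q : ℝ → ℝ := fun s => ∫ p, φ (s, p) * ρ (s, p)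
    ∂(((deltaMeasure T₂).restrict (Ico y₀ Y)).prod ((deltaMeasure T₃).restrict (Ico a b)))
  have hQ : BddMeas Q :=
    BddMeas.integral (χ := fun (s : ℝ) (p : ℝ × ℝ) => φ (s, p) * ρ (s, p)) (hφ.mul hρ) _
  have hQ0 : ∀ s, 0 ≤ Q s := fun s =>
    integral_nonneg fun p => mul_nonneg (hφ0 _) (hρ0 _)
  have hWle : ∀ x ∈ T₁ ∩ Icc x₀ X,
      W x ≤ C + ∫ s in Ico x₀ x, Q s * W s ∂deltaMeasure T₁ := fun x hx => by
    have hφρW : BddMeas fun p : ℝ × ℝ × ℝ => φ p * ρ p * W p.1 :=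
      (hφ.mul hρ).mul (hW.comp measurable_fst)
    have h1 : W x ≤ ∫ p, (φ p * κ p + if p.1 < x then φ p * ρ p * W p.1 else 0) ∂ν := by
      refine integral_mono_ae (((hφ.mul hw).cut_fst _).integrable ν)
        (((hφ.mul hκ).add (hφρW.cut_fst x)).integrable ν) ?_
      filter_upwards [hae] with p hp
      split_ifs
      · calc φ p * w p ≤ φ p * (κ p + ρ p * W p.1) :=
              mul_le_mul_of_nonneg_left (hwW p hp.1) (hφ0 p)
          _ = _ := by ring
      · simpa using hφκ0 p
    rw [integral_add ((hφ.mul hκ).integrable ν) ((hφρW.cut_fst x).integrable ν)] at h1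
    refine h1.trans (add_le_add_right (le_of_eq ?_) _)
    rw [hν, boxMeasure, integral_prod _ ((hφρW.cut_fst x).integrable _),
      ← setIntegral_Ico_ite hx.2.2]
    refine integral_congr_ae (Eventually.of_forall fun s => ?_)
    dsimp only
    split_ifs
    · rw [integral_mul_const]
    · simp
  obtain ⟨MQ, hMQ⟩ := hQ.2
  obtain ⟨MW, hMW⟩ := hW.2
  have hgr := gronwall_delta h₁ hx₀ hX hxX hQ.1 hQ0 (fun s => (le_abs_self _).trans (hMQ s)) hW.1
    hW0 (fun s => (le_abs_self _).trans (hMW s)) hC hWle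
  rintro p hp rfl
  exact (hwW p hp).trans (add_le_add_right (mul_le_mul_of_nonneg_left hgr (hρ0 p)) _)

end Box

end TimeScale

theorem theorem3p2 (T₁ T₂ T₃ : Set ℝ)
    (hT₁ : TimeScale.IsTimeScale T₁) (hT₂ : TimeScale.IsTimeScale T₂)
    (hT₃ : TimeScale.IsTimeScale T₃)
    (x₀ y₀ a b : ℝ) (hx₀ : x₀ ∈ T₁) (hy₀ : y₀ ∈ T₂) (ha : a ∈ T₃) (hb : b ∈ T₃) (hab : a ≤ b)
    (u g r f : ℝ → ℝ → ℝ → ℝ) (F : ℝ → ℝ → ℝ → ℝ → ℝ → ℝ → ℝ → ℝ)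
    (hu : TimeScale.Crd3 T₁ T₂ (T₃ ∩ Set.Icc a b) u)
    (hg : TimeScale.Crd3 T₁ T₂ (T₃ ∩ Set.Icc a b) g)
    (hr : TimeScale.Crd3 T₁ T₂ (T₃ ∩ Set.Icc a b) r)
    (hf : TimeScale.Crd3 T₁ T₂ (T₃ ∩ Set.Icc a b) f)
    (hF : TimeScale.Crd7 T₁ T₂ (T₃ ∩ Set.Icc a b) F)
    (hLip : ∀ x ∈ T₁ ∩ Set.Ici x₀, ∀ y ∈ T₂ ∩ Set.Ici y₀, ∀ z ∈ T₃ ∩ Set.Icc a b,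
      ∀ s ∈ T₁ ∩ Set.Ici x₀, ∀ t ∈ T₂ ∩ Set.Ici y₀, ∀ q ∈ T₃ ∩ Set.Icc a b, ∀ v w : ℝ,
        |F x y z s t q v - F x y z s t q w| ≤ r x y z * f s t q * |v - w|)
    (hsol : ∀ x ∈ T₁ ∩ Set.Ici x₀, ∀ y ∈ T₂ ∩ Set.Ici y₀, ∀ z ∈ T₃ ∩ Set.Icc a b,
      u x y z = g x y z + TimeScale.tripleIntegral T₁ T₂ T₃ x₀ y₀ a b x y
        fun s t q => F x y z s t q (u s t q)) :
    ∀ x ∈ T₁ ∩ Set.Ici x₀, ∀ y ∈ T₂ ∩ Set.Ici y₀, ∀ z ∈ T₃ ∩ Set.Icc a b,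
      |u x y z - g x y z| ≤
        TimeScale.kFun T₁ T₂ T₃ x₀ y₀ a b F g x y z +
          r x y z *
            TimeScale.C₃ T₁ T₂ T₃ x₀ y₀ a b f (TimeScale.kFun T₁ T₂ T₃ x₀ y₀ a b F g) x y *
            TimeScale.expTS T₁ (fun s => TimeScale.Q₂ T₂ T₃ y₀ a b f r s y) x x₀ := by
  open TimeScale in
  rintro X ⟨hX, hxX⟩ Y ⟨hY, hyY⟩ Z hZ
  rw [mem_Ici] at hxX hyY
  have c₁ := hT₁.2
  have c₂ := hT₂.2
  have c₃ := hT₃.2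
  -- restrict all data to the compact box below `(X, Y)`
  have hK₁ : IsCompact (T₁ ∩ Icc x₀ X) := isCompact_Icc.inter_left c₁
  have hK₂ : IsCompact (T₂ ∩ Icc y₀ Y) := isCompact_Icc.inter_left c₂
  have hK₃ : IsCompact (T₃ ∩ Icc a b) := isCompact_Icc.inter_left c₃
  have c₃' : IsClosed (T₃ ∩ Icc a b) := c₃.inter isClosed_Icc
  have ext {h : ℝ → ℝ → ℝ → ℝ} (hh : Crd3 T₁ T₂ (T₃ ∩ Icc a b) h) :=
    hh.exists_bddMeas c₁ c₂ c₃' hK₁ hK₂ hK₃ inter_subset_left inter_subset_left subset_rfl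
  obtain ⟨u', hu', eu⟩ := ext hu
  obtain ⟨g', hg', eg⟩ := ext hg
  obtain ⟨r', hr', er⟩ := ext hr
  obtain ⟨f', hf', ef⟩ := ext hf
  obtain ⟨Nu, hNu⟩ := hu'.2
  obtain ⟨Ng, hNg⟩ := hg'.2
  obtain ⟨F', hF', eF⟩ := hF.exists_bddMeas c₁ c₂ c₃' hK₁ hK₂ hK₃ inter_subset_left
    inter_subset_left subset_rfl (max Nu Ng)
  have eFu : ∀ p ∈ (T₁ ∩ Icc x₀ X) ×ˢ (T₂ ∩ Icc y₀ Y) ×ˢ (T₃ ∩ Icc a b),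
      ∀ p' ∈ (T₁ ∩ Icc x₀ X) ×ˢ (T₂ ∩ Icc y₀ Y) ×ˢ (T₃ ∩ Icc a b),
      F' (p, p', u' p') = F p.1 p.2.1 p.2.2 p'.1 p'.2.1 p'.2.2 (u p'.1 p'.2.1 p'.2.2) :=
    fun p hp p' hp' => by
      rw [eF p hp p' hp' _ ((hNu p').trans (le_max_left _ _)), eu p' hp']
  have eFg : ∀ p ∈ (T₁ ∩ Icc x₀ X) ×ˢ (T₂ ∩ Icc y₀ Y) ×ˢ (T₃ ∩ Icc a b),
      ∀ p' ∈ (T₁ ∩ Icc x₀ X) ×ˢ (T₂ ∩ Icc y₀ Y) ×ˢ (T₃ ∩ Icc a b),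
      F' (p, p', g' p') = F p.1 p.2.1 p.2.2 p'.1 p'.2.1 p'.2.2 (g p'.1 p'.2.1 p'.2.2) :=
    fun p hp p' hp' => by
      rw [eF p hp p' hp' _ ((hNg p').trans (le_max_right _ _)), eg p' hp']
  set K : Set (ℝ × ℝ × ℝ) := (T₁ ∩ Icc x₀ X) ×ˢ (T₂ ∩ Icc y₀ Y) ×ˢ (T₃ ∩ Icc a b)
  have lip : ∀ p ∈ K, ∀ p' ∈ K, ∀ v w : ℝ,
      |F p.1 p.2.1 p.2.2 p'.1 p'.2.1 p'.2.2 v - F p.1 p.2.1 p.2.2 p'.1 p'.2.1 p'.2.2 w| ≤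
        r' p * f' p' * |v - w| := fun p hp p' hp' v w => by
    rw [er p hp, ef p' hp']
    exact hLip _ ⟨hp.1.1, hp.1.2.1⟩ _ ⟨hp.2.1.1, hp.2.1.2.1⟩ _ hp.2.2 _ ⟨hp'.1.1, hp'.1.2.1⟩ _
      ⟨hp'.2.1.1, hp'.2.1.2.1⟩ _ hp'.2.2 v w
  -- the Lipschitz condition forces the product of `r` and `f` to be nonnegative, so that `|r|` and
  -- `|f|` can take the places of `r` and `f`
  have hrf : ∀ p ∈ K, ∀ p' ∈ K, r' p * f' p' = |f' p'| * |r' p| := fun p hp p' hp' => by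
    have h := (abs_nonneg _).trans (lip p hp p' hp' 1 0)
    rw [sub_zero, abs_one, mul_one] at h
    rw [mul_comm |f' p'|, ← abs_mul, abs_of_nonneg h]
  set ν := boxMeasure T₁ T₂ T₃ x₀ X y₀ Y a b with hν
  have : IsFiniteMeasure ν := isFiniteMeasure_boxMeasure c₁ c₂ c₃ hx₀ hX hy₀ hY ha hb
  have hae : ∀ᵐ p ∂ν, p ∈ K ∧ p.1 < X ∧ p.2.1 < Y :=
    ae_mem_boxMeasure c₁ c₂ c₃ hx₀ hX hy₀ hY ha hb
  have triple {x y : ℝ} (hx : x ∈ T₁ ∩ Icc x₀ X) (hy : y ∈ T₂ ∩ Icc y₀ Y)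
      {φ : ℝ → ℝ → ℝ → ℝ} {φ' : ℝ × ℝ × ℝ → ℝ} (hφ' : BddMeas φ')
      (h : ∀ p ∈ K, φ' p = φ p.1 p.2.1 p.2.2) :
      tripleIntegral T₁ T₂ T₃ x₀ y₀ a b x y φ =
        ∫ p, (if p.1 < x ∧ p.2.1 < y then φ' p else 0) ∂ν :=
    tripleIntegral_eq c₁ c₂ c₃ hx₀ hX hy₀ hY ha hb hab hx hy hφ' h
  set w : ℝ × ℝ × ℝ → ℝ := fun p => |u' p - g' p| with hwdef
  have hw : BddMeas w := (hu'.sub hg').abs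
  set fa : ℝ × ℝ × ℝ → ℝ := fun p => |f' p|
  set ra : ℝ × ℝ × ℝ → ℝ := fun p => |r' p|
  have hfa : BddMeas fa := hf'.abs
  have hra : BddMeas ra := hr'.abs
  have hFu : ∀ p, BddMeas fun p' => F' (p, p', u' p') := fun p =>
    hF'.comp (measurable_const.prodMk (measurable_id.prodMk hu'.1))
  have hFg : ∀ p, BddMeas fun p' => F' (p, p', g' p') := fun p =>
    hF'.comp (measurable_const.prodMk (measurable_id.prodMk hg'.1))
  set k : ℝ × ℝ × ℝ → ℝ := fun p =>
    ∫ p', (if p'.1 < p.1 ∧ p'.2.1 < p.2.1 then |F' (p, p', g' p')| else 0) ∂ν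
  have hk : BddMeas k := by
    refine BddMeas.integral_cut (χ := fun p p' => |F' (p, p', g' p')|) (BddMeas.abs (hF'.comp ?_))
    exact measurable_fst.prodMk (measurable_snd.prodMk (hg'.1.comp measurable_snd))
  have hk0 : ∀ p, 0 ≤ k p := fun p => integral_nonneg fun p' => by
    dsimp only
    split_ifs
    · exact abs_nonneg _
    · exact le_rfl
  have ek : ∀ p ∈ K, kFun T₁ T₂ T₃ x₀ y₀ a b F g p.1 p.2.1 p.2.2 = k p := fun p hp =>
    triple hp.1 hp.2.1 (hFg p).abs fun p' hp' => by rw [eFg p hp p' hp']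
  have hwk : ∀ p ∈ K, w p ≤ k p + ra p *
      ∫ p', (if p'.1 < p.1 ∧ p'.2.1 < p.2.1 then fa p' * w p' else 0) ∂ν := fun p hp => by
    have h1 : u' p - g' p =
        ∫ p', (if p'.1 < p.1 ∧ p'.2.1 < p.2.1 then F' (p, p', u' p') else 0) ∂ν := by
      rw [eu p hp, eg p hp, hsol _ ⟨hp.1.1, hp.1.2.1⟩ _ ⟨hp.2.1.1, hp.2.1.2.1⟩ _ hp.2.2,
        add_sub_cancel_left]
      exact triple hp.1 hp.2.1 (hFu p) fun p' hp' => eFu p hp p' hp'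
    have h2 : w p ≤ ∫ p', ((if p'.1 < p.1 ∧ p'.2.1 < p.2.1 then |F' (p, p', g' p')| else 0) +
        ra p * (if p'.1 < p.1 ∧ p'.2.1 < p.2.1 then fa p' * w p' else 0)) ∂ν := by
      simp only [hwdef, h1]
      refine abs_integral_le_integral_abs.trans (integral_mono_ae
        (((hFu p).cut _ _).abs.integrable ν) ((((hFg p).abs.cut _ _).add
          ((BddMeas.const (ra p)).mul ((hfa.mul hw).cut _ _))).integrable ν) ?_)
      filter_upwards [hae] with p' hp'
      split_ifs
      · have hl := lip p hp p' hp'.1 (u' p') (g' p')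
        rw [hrf p hp p' hp'.1, ← eF p hp p' hp'.1 _ ((hNu p').trans (le_max_left _ _)),
          ← eF p hp p' hp'.1 _ ((hNg p').trans (le_max_right _ _))] at hl
        have ht := abs_sub_abs_le_abs_sub (F' (p, p', u' p')) (F' (p, p', g' p'))
        calc |F' (p, p', u' p')| ≤ |F' (p, p', g' p')| + fa p' * ra p * w p' := by linarith
          _ = _ := by ring
      · simp
    rw [integral_add (((hFg p).abs.cut _ _).integrable ν)
      (((BddMeas.const (ra p)).mul ((hfa.mul hw).cut _ _)).integrable ν),
      integral_const_mul] at h2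
    exact h2
  have fin₂ := isFiniteMeasure_deltaMeasure_restrict c₂ hy₀ hY
  have fin₃ := isFiniteMeasure_deltaMeasure_restrict c₃ ha hb
  have hP : ((X, Y, Z) : ℝ × ℝ × ℝ) ∈ K := ⟨⟨hX, hxX, le_rfl⟩, ⟨hY, hyY, le_rfl⟩, hZ⟩
  have eQ : ∀ s ∈ T₁ ∩ Icc x₀ X, Q₂ T₂ T₃ y₀ a b f r s Y =
      ∫ p, fa (s, p) * ra (s, p)
        ∂(((deltaMeasure T₂).restrict (Ico y₀ Y)).prod ((deltaMeasure T₃).restrict (Ico a b))) :=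
      fun s hs => by
    rw [Q₂, deltaIntegral_of_le hyY,
      integral_prod _ (((hfa.mul hra).comp measurable_prodMk_left).integrable _)]
    refine setIntegral_deltaMeasure_congr c₂ hy₀ hY fun t ht => ?_
    rw [deltaIntegral_of_le hab]
    refine setIntegral_deltaMeasure_congr c₃ ha hb fun q hq => ?_
    have hp : ((s, t, q) : ℝ × ℝ × ℝ) ∈ K := ⟨hs, ht, hq⟩
    rw [← hrf _ hp _ hp, er _ hp, ef _ hp, mul_comm]
  have eexp : expTS T₁ (fun s => Q₂ T₂ T₃ y₀ a b f r s Y) X x₀ =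
      Real.exp (∫ t in Ico x₀ X, cylinder (graininess T₁ t) (∫ p, fa (t, p) * ra (t, p)
        ∂(((deltaMeasure T₂).restrict (Ico y₀ Y)).prod ((deltaMeasure T₃).restrict (Ico a b))))
        ∂deltaMeasure T₁) := by
    rw [expTS, deltaIntegral_of_le hxX]
    congr 1
    exact setIntegral_deltaMeasure_congr c₁ hx₀ hX fun s hs => by rw [eQ s hs]
  have eC : r X Y Z * C₃ T₁ T₂ T₃ x₀ y₀ a b f (kFun T₁ T₂ T₃ x₀ y₀ a b F g) X Y =
      ra (X, Y, Z) * ∫ p, fa p * k p ∂ν := by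
    rw [C₃, triple ⟨hX, hxX, le_rfl⟩ ⟨hY, hyY, le_rfl⟩ (hf'.mul hk.abs)
      fun p hp => by rw [ef p hp, ek p hp], ← integral_const_mul, ← integral_const_mul]
    refine integral_congr_ae ?_
    filter_upwards [hae] with p hp
    rw [if_pos hp.2, abs_of_nonneg (hk0 p), ← mul_assoc, ← mul_assoc, mul_comm (ra _),
      ← hrf _ hP _ hp.1,
      er _ hP]
  have hfinal := gronwall_box c₁ c₂ c₃ hx₀ hX hy₀ hY ha hb hxX hfa hra hk hw
    (fun _ => abs_nonneg _) (fun _ => abs_nonneg _) hk0 (fun _ => abs_nonneg _) hwk _ hP rfl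
  have hk' := ek _ hP
  simp only [hwdef] at hfinal
  rw [eu _ hP, eg _ hP] at hfinal
  rw [eC, eexp, hk', mul_assoc]
  exact hfinal
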